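/- Let $BVC[0,1]$ be the real vector space of all continuous functions $f:[0,1]\to\mathbb{R}$ of bounded variation, with the norm $\|f\|=\|f\|_\infty+\operatorname{Var}(f)$, where $\operatorname{Var}(f)$ is the total variation of $f$ on $[0,1]$, and let $AC[0,1]\subset BVC[0,1]$ be the set of absolutely continuous functions $[0,1]\to\mathbb{R}$. Write $\mathfrak{c}=\mathrm{card}(\mathbb{R})$ and $\aleph_0=\mathrm{card}(\mathbb{N})$. For a topological vector space $E$, a subset $A\subset E$ and cardinals $\alpha,\beta$, say that $A$ is $(\alpha,\beta)$-spaceable in $E$ if 1. $A$ is $\alpha$-lineable, i.e. there is a linear subspace $F\subset E$ with $\dim F=\alpha$ and $F\smallsetminus\{0\}\subset A$; and 2. for every linear subspace $F_\alpha\subset E$ with $\dim F_\alpha=\alpha$ and $F_\alpha\subset A\cup\{0\}$ there is a closed linear subspace $F_\beta\subset E$ with $\dim F_\beta=\beta$ and $F_\alpha\subset F_\beta\subset A\cup\{0\}$. Then, for every cardinal $\alpha$, the set $BVC[0,1]\smallsetminus AC[0,1]$ is $(\alpha,\mathfrak{c})$-spaceable in $BVC[0,1]$ if and only if $\alpha<\aleph_0$.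 -/

import Mathlib

open Set
open scoped unitInterval ENNReal Cardinal

/-! ### Lineability and spaceability -/

section Spaceability

universe u v

variable (K : Type v) {E : Type u} [Field K] [AddCommGroup E] [Module K E]

/-- A subset `A` of a `K`-vector space is `β`-lineable if there is a subspace `F` of dimension `β`
with `F \ {0} ⊆ A`. -/
def IsLineable (β : Cardinal.{u}) (A : Set E) : Prop :=
  ∃ F : Submodule K E, Module.rank K F = β ∧ (F : Set E) \ {0} ⊆ A

/-- A subset `A` of a topological `K`-vector space is `(α, β)`-spaceable if it is `α`-lineable and
every `α`-dimensional subspace contained in `A ∪ {0}` is contained in a closed `β`-dimensional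
subspace contained in `A ∪ {0}`. (One usually considers this for `α < β`.) -/
def IsPairSpaceable [TopologicalSpace E] (α β : Cardinal.{u}) (A : Set E) : Prop :=
  IsLineable K α A ∧
    ∀ F : Submodule K E, Module.rank K F = α → (F : Set E) ⊆ A ∪ {0} →
      ∃ G : Submodule K E, Module.rank K G = β ∧ IsClosed (G : Set E) ∧ F ≤ G ∧
        (G : Set E) ⊆ A ∪ {0}

end Spaceability

/-! ### Variation is a seminorm -/

theorem eVariationOn_add_le_add (f g : I → ℝ) (s : Set I) :
    eVariationOn (f + g) s ≤ eVariationOn f s + eVariationOn g s := by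
  refine iSup_le fun p => ?_
  calc ∑ i ∈ Finset.range p.1, edist ((f + g) (p.2.1 (i + 1))) ((f + g) (p.2.1 i))
      ≤ ∑ i ∈ Finset.range p.1, (edist (f (p.2.1 (i + 1))) (f (p.2.1 i)) +
          edist (g (p.2.1 (i + 1))) (g (p.2.1 i))) :=
        Finset.sum_le_sum fun i _ => edist_add_add_le _ _ _ _
    _ = ∑ i ∈ Finset.range p.1, edist (f (p.2.1 (i + 1))) (f (p.2.1 i)) +
          ∑ i ∈ Finset.range p.1, edist (g (p.2.1 (i + 1))) (g (p.2.1 i)) :=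
        Finset.sum_add_distrib
    _ ≤ _ := add_le_add (eVariationOn.sum_le p.2.2.1 p.2.2.2)
        (eVariationOn.sum_le p.2.2.1 p.2.2.2)

theorem eVariationOn_const_smul_eq (c : ℝ) (f : I → ℝ) (s : Set I) :
    eVariationOn (c • f) s = ‖c‖ₑ * eVariationOn f s := by
  simp only [eVariationOn, ENNReal.mul_iSup, Finset.mul_sum]
  refine iSup_congr fun p => Finset.sum_congr rfl fun i _ => ?_
  rw [Pi.smul_apply, Pi.smul_apply, edist_smul₀, ENNReal.smul_def, smul_eq_mul, enorm_eq_nnnorm]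

/-! ### The normed space of continuous functions of bounded variation on `[0, 1]` -/

/-- The continuous functions `[0, 1] → ℝ` of bounded variation, as a subspace of `C[0, 1]`. -/
def bvcSubmodule : Submodule ℝ C(I, ℝ) where
  carrier := {f | BoundedVariationOn f univ}
  zero_mem' := by
    have h : eVariationOn (⇑(0 : C(I, ℝ))) univ = 0 :=
      eVariationOn.constant_on (by rintro _ ⟨x, -, rfl⟩ _ ⟨y, -, rfl⟩; rfl)
    exact h.trans_ne ENNReal.zero_ne_top
  add_mem' := fun {f g} hf hg =>
    ne_top_of_le_ne_top (ENNReal.add_ne_top.2 ⟨hf, hg⟩) (eVariationOn_add_le_add f g univ)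
  smul_mem' := fun c f hf => by
    change eVariationOn (c • (f : I → ℝ)) univ ≠ ∞
    rw [eVariationOn_const_smul_eq]
    exact ENNReal.mul_ne_top enorm_ne_top hf

/-- The space `BVC[0, 1]`. It is a type of its own, so that it does not inherit the
supremum norm of `C[0, 1]`; its norm is given below. -/
def BVC : Type := bvcSubmodule

namespace BVC

noncomputable instance : AddCommGroup BVC := inferInstanceAs (AddCommGroup bvcSubmodule)

noncomputable instance : Module ℝ BVC := inferInstanceAs (Module ℝ bvcSubmodule)

/-- The underlying continuous function, with the linear structure. -/
noncomputable def toContinuousMap : BVC →ₗ[ℝ] C(I, ℝ) := bvcSubmodule.subtype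

noncomputable instance : CoeFun BVC (fun _ => I → ℝ) := ⟨fun f => toContinuousMap f⟩

/-- The total variation on `[0, 1]`; it is finite for every `f : BVC`. -/
noncomputable def Var (f : BVC) : ℝ := (eVariationOn (f : I → ℝ) univ).toReal

theorem eVariationOn_ne_top (f : BVC) : eVariationOn (f : I → ℝ) univ ≠ ∞ := f.2

theorem toContinuousMap_injective : Function.Injective toContinuousMap :=
  Subtype.val_injective

theorem Var_smul (c : ℝ) (f : BVC) : Var (c • f) = ‖c‖ * Var f := by
  have h : ((c • f : BVC) : I → ℝ) = c • (f : I → ℝ) := by rw [map_smul]; rfl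
  rw [Var, h, eVariationOn_const_smul_eq, ENNReal.toReal_mul, toReal_enorm, Var]

theorem Var_add_le (f g : BVC) : Var (f + g) ≤ Var f + Var g := by
  have h : ((f + g : BVC) : I → ℝ) = (f : I → ℝ) + (g : I → ℝ) := by rw [map_add]; rfl
  rw [Var, h, Var, Var, ← ENNReal.toReal_add f.eVariationOn_ne_top g.eVariationOn_ne_top]
  exact ENNReal.toReal_mono
    (ENNReal.add_ne_top.2 ⟨f.eVariationOn_ne_top, g.eVariationOn_ne_top⟩)
    (eVariationOn_add_le_add _ _ _)

/-- `‖f‖ = ‖f‖_∞ + Var f`. -/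
noncomputable instance : Norm BVC := ⟨fun f => ‖toContinuousMap f‖ + Var f⟩

theorem norm_def (f : BVC) : ‖f‖ = ‖toContinuousMap f‖ + Var f := rfl

theorem normCore : NormedSpace.Core ℝ BVC where
  norm_nonneg f := add_nonneg (norm_nonneg _) ENNReal.toReal_nonneg
  norm_smul c f := by rw [norm_def, norm_def, map_smul, norm_smul, Var_smul, mul_add]
  norm_triangle f g := by
    have h1 := norm_add_le (toContinuousMap f) (toContinuousMap g)
    have h2 := Var_add_le f g
    rw [norm_def, norm_def, norm_def, map_add]
    linarith
  norm_eq_zero_iff f := by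
    constructor
    · intro h
      have h1 : 0 ≤ Var f := ENNReal.toReal_nonneg
      have h2 := norm_nonneg (toContinuousMap f)
      rw [norm_def] at h
      have h3 : toContinuousMap f = 0 := norm_eq_zero.1 (by linarith)
      exact toContinuousMap_injective (by rw [h3, map_zero])
    · rintro rfl
      have h := Var_smul 0 (0 : BVC)
      rw [zero_smul, norm_zero, zero_mul] at h
      rw [norm_def, map_zero, norm_zero, h, add_zero]

noncomputable instance : NormedAddCommGroup BVC := NormedAddCommGroup.ofCore normCore

noncomputable instance : NormedSpace ℝ BVC := NormedSpace.ofCore normCore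

end BVC

/-- The set `AC[0, 1]` of absolutely continuous functions `[0, 1] → ℝ`. Mathlib's predicate is
about functions on `ℝ` but only looks at their values on `[0, 1]`, so that the choice of the
extension `IccExtend` does not matter. -/
def AC : Set (I → ℝ) :=
  {f | AbsolutelyContinuousOnInterval (IccExtend (zero_le_one' ℝ) f) 0 1}

/-! ### The Cantor set is null -/

/-! `AC` is a linear subspace, so a subspace lies in its complement together with 0 exactly when it
meets `AC` trivially. If α is infinite, shear such a subspace along a nonzero g in `AC`, sending w
to w + φ(w)g with φ an unbounded functional. The image still avoids `AC`, but g is in its closure,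
so no closed extension avoids `AC` (`exists_rank_eq_disjoint_mem_closure`). If α is finite, use the
closed space M of functions that vanish at 0 and factor through the Cantor function. They are
locally constant off a null set, so only 0 is absolutely continuous
(`disjoint_cantorSubmodule_acSubmodule`); hinges composed with the Cantor function give M dimension
𝔠. For finite-dimensional F avoiding `AC`, only a finite-dimensional part of M meets F + `AC`;
cutting it out of M and adding F gives the closed extension (`exists_isClosed_ge_disjoint`). -/

open scoped Pointwise in
theorem volume_preCantorSet_le (n : ℕ) :
    MeasureTheory.volume (preCantorSet n) ≤ ENNReal.ofReal ((2 / 3) ^ n) := by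
  induction n with
  | zero => simp
  | succ n ih =>
    have h1 : (· / 3) '' preCantorSet n = (3⁻¹ : ℝ) • preCantorSet n :=
      image_congr fun x _ => by rw [smul_eq_mul, div_eq_inv_mul]
    have h2 : (fun x : ℝ => (2 + x) / 3) '' preCantorSet n
        = (3⁻¹ : ℝ) • ((fun x => 2 + x) '' preCantorSet n) := by
      rw [← image_smul, image_image]
      exact image_congr fun x _ => by rw [smul_eq_mul, div_eq_inv_mul]
    have h3 : ENNReal.ofReal ((2 / 3) ^ (n + 1))
        = ENNReal.ofReal 3⁻¹ * ENNReal.ofReal ((2 / 3) ^ n)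
          + ENNReal.ofReal 3⁻¹ * ENNReal.ofReal ((2 / 3) ^ n) := by
      rw [← ENNReal.ofReal_mul (by norm_num), ← ENNReal.ofReal_add (by positivity) (by positivity)]
      congr 1
      ring
    rw [preCantorSet_succ, h1, h2, h3]
    refine (MeasureTheory.measure_union_le _ _).trans (add_le_add ?_ ?_)
    · rw [MeasureTheory.Measure.addHaar_smul]
      simp only [Module.finrank_self, pow_one, abs_of_pos (show (0 : ℝ) < 3⁻¹ by norm_num)]
      gcongr
    · rw [MeasureTheory.Measure.addHaar_smul, image_add_left, MeasureTheory.measure_preimage_add]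
      simp only [Module.finrank_self, pow_one, abs_of_pos (show (0 : ℝ) < 3⁻¹ by norm_num)]
      gcongr

theorem volume_cantorSet : MeasureTheory.volume cantorSet = 0 := by
  have h : Filter.Tendsto (fun n : ℕ => ENNReal.ofReal ((2 / 3) ^ n)) Filter.atTop (nhds 0) := by
    rw [← ENNReal.ofReal_zero]
    exact ENNReal.tendsto_ofReal
      (tendsto_pow_atTop_nhds_zero_of_lt_one (by norm_num) (by norm_num))
  exact le_antisymm (ge_of_tendsto' h fun n =>
    (MeasureTheory.measure_mono (iInter_subset _ n)).trans (volume_preCantorSet_le n)) zero_le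

/-! ### The Cantor function -/

/-- The iterates that converge to the Cantor function. -/
noncomputable def cantorApprox : ℕ → ℝ → ℝ
  | 0 => fun x => max 0 (min x 1)
  | n + 1 => fun x => (cantorApprox n (3 * x) + cantorApprox n (3 * x - 2)) / 2

theorem cantorApprox_succ (n : ℕ) (x : ℝ) :
    cantorApprox (n + 1) x = (cantorApprox n (3 * x) + cantorApprox n (3 * x - 2)) / 2 := rfl

theorem cantorApprox_of_nonpos (n : ℕ) {x : ℝ} (hx : x ≤ 0) : cantorApprox n x = 0 := by
  induction n generalizing x with
  | zero => simp [cantorApprox, hx]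
  | succ n ih => rw [cantorApprox_succ, ih (by linarith), ih (by linarith)]; norm_num

theorem cantorApprox_of_one_le (n : ℕ) {x : ℝ} (hx : 1 ≤ x) : cantorApprox n x = 1 := by
  induction n generalizing x with
  | zero => simp [cantorApprox, hx]
  | succ n ih => rw [cantorApprox_succ, ih (by linarith), ih (by linarith)]; norm_num

theorem monotone_cantorApprox (n : ℕ) : Monotone (cantorApprox n) := by
  induction n with
  | zero => exact fun x y h => max_le_max le_rfl (min_le_min h le_rfl)
  | succ n ih =>
    intro x y h
    have h1 := ih (show 3 * x ≤ 3 * y by linarith)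
    have h2 := ih (show 3 * x - 2 ≤ 3 * y - 2 by linarith)
    simp only [cantorApprox]
    linarith

theorem continuous_cantorApprox (n : ℕ) : Continuous (cantorApprox n) := by
  induction n with
  | zero => unfold cantorApprox; fun_prop
  | succ n ih => unfold cantorApprox; fun_prop

/-- On each side of 1/2, one of the two averaged terms is evaluated where all iterates agree, so
only the other carries an error and the average halves it. -/
theorem dist_cantorApprox_succ_le (n : ℕ) (x : ℝ) :
    dist (cantorApprox n x) (cantorApprox (n + 1) x) ≤ 1 * (1 / 2) ^ n := by
  induction n generalizing x with
  | zero =>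
    have h01 : ∀ n y, 0 ≤ cantorApprox n y ∧ cantorApprox n y ≤ 1 := fun n y =>
      ⟨(cantorApprox_of_nonpos n (min_le_right y 0)).ge.trans
          (monotone_cantorApprox n (min_le_left y 0)),
        (monotone_cantorApprox n (le_max_left y 1)).trans
          (cantorApprox_of_one_le n (le_max_right y 1)).le⟩
    have h0 := h01 0 x
    have h1 := h01 1 x
    rw [Real.dist_eq, abs_le]
    constructor <;> norm_num <;> linarith
  | succ n ih =>
    have h1 := ih (3 * x)
    have h2 := ih (3 * x - 2)
    rw [Real.dist_eq] at h1 h2 ⊢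
    have h : cantorApprox (n + 1) x - cantorApprox (n + 1 + 1) x =
        ((cantorApprox n (3 * x) - cantorApprox (n + 1) (3 * x)) +
          (cantorApprox n (3 * x - 2) - cantorApprox (n + 1) (3 * x - 2))) / 2 := by
      rw [cantorApprox_succ n x, cantorApprox_succ (n + 1) x]; ring
    rw [h, pow_succ, abs_div, abs_two]
    rcases le_total x (1 / 2) with hx | hx
    · rw [cantorApprox_of_nonpos n (show 3 * x - 2 ≤ 0 by linarith),
        cantorApprox_of_nonpos (n + 1) (show 3 * x - 2 ≤ 0 by linarith), sub_zero, add_zero]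
      linarith
    · rw [cantorApprox_of_one_le n (show 1 ≤ 3 * x by linarith),
        cantorApprox_of_one_le (n + 1) (show 1 ≤ 3 * x by linarith), sub_self, zero_add]
      linarith

theorem exists_tendsto_cantorApprox (x : ℝ) :
    ∃ y, Filter.Tendsto (fun n => cantorApprox n x) Filter.atTop (nhds y) :=
  cauchySeq_tendsto_of_complete
    (cauchySeq_of_le_geometric _ _ (by norm_num) fun n => dist_cantorApprox_succ_le n x)

/-- The Cantor function, extended to `ℝ` by constants. -/
noncomputable def cantorStaircase (x : ℝ) : ℝ := (exists_tendsto_cantorApprox x).choose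

theorem tendsto_cantorApprox (x : ℝ) :
    Filter.Tendsto (fun n => cantorApprox n x) Filter.atTop (nhds (cantorStaircase x)) :=
  (exists_tendsto_cantorApprox x).choose_spec

theorem cantorStaircase_of_nonpos {x : ℝ} (hx : x ≤ 0) : cantorStaircase x = 0 :=
  tendsto_nhds_unique (tendsto_cantorApprox x)
    (by simp only [cantorApprox_of_nonpos _ hx, tendsto_const_nhds])

theorem cantorStaircase_of_one_le {x : ℝ} (hx : 1 ≤ x) : cantorStaircase x = 1 :=
  tendsto_nhds_unique (tendsto_cantorApprox x)
    (by simp only [cantorApprox_of_one_le _ hx, tendsto_const_nhds])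

theorem monotone_cantorStaircase : Monotone cantorStaircase := fun x y h =>
  le_of_tendsto_of_tendsto' (tendsto_cantorApprox x) (tendsto_cantorApprox y)
    fun n => monotone_cantorApprox n h

theorem cantorStaircase_eq (x : ℝ) :
    cantorStaircase x = (cantorStaircase (3 * x) + cantorStaircase (3 * x - 2)) / 2 :=
  tendsto_nhds_unique ((tendsto_cantorApprox x).comp (Filter.tendsto_add_atTop_nat 1))
    (((tendsto_cantorApprox _).add (tendsto_cantorApprox _)).div_const 2)

theorem continuous_cantorStaircase : Continuous cantorStaircase := by
  refine TendstoUniformly.continuous (F := cantorApprox) (p := Filter.atTop) ?_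
    (Filter.Frequently.of_forall continuous_cantorApprox)
  rw [Metric.tendstoUniformly_iff]
  intro ε hε
  have h : Filter.Tendsto (fun n : ℕ => (1 : ℝ) * (1 / 2) ^ n / (1 - 1 / 2))
      Filter.atTop (nhds 0) := by
    simpa using ((tendsto_pow_atTop_nhds_zero_of_lt_one (r := (1 / 2 : ℝ)) (by norm_num)
      (by norm_num)).const_mul 1).div_const (1 - 1 / 2)
  filter_upwards [h.eventually_lt_const hε] with n hn x
  rw [dist_comm]
  exact (dist_le_of_le_geometric_of_tendsto _ _ (by norm_num)
    (fun n => dist_cantorApprox_succ_le n x) (tendsto_cantorApprox x) n).trans_lt hn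

theorem cantorStaircase_projIcc (x : ℝ) :
    cantorStaircase (projIcc 0 1 zero_le_one x) = cantorStaircase x := by
  rcases le_total x 0 with h | h
  · rw [projIcc_of_le_left _ h, cantorStaircase_of_nonpos h, cantorStaircase_of_nonpos le_rfl]
  · rcases le_total 1 x with h' | h'
    · rw [projIcc_of_right_le _ h', cantorStaircase_of_one_le h', cantorStaircase_of_one_le le_rfl]
    · rw [projIcc_of_mem _ ⟨h, h'⟩]

/-- Outside stage n + 1, both 3x and 3x - 2 are outside stage n, and the functional equation carries
local constancy back to x. -/
theorem eventually_cantorStaircase_eq_of_notMem_preCantorSet (n : ℕ) {x : ℝ}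
    (hx : x ∉ preCantorSet n) : ∀ᶠ y in nhds x, cantorStaircase y = cantorStaircase x := by
  induction n generalizing x with
  | zero =>
    rw [preCantorSet_zero, mem_Icc, not_and_or, not_le, not_le] at hx
    rcases hx with hx | hx
    · filter_upwards [gt_mem_nhds hx] with y hy
      rw [cantorStaircase_of_nonpos hy.le, cantorStaircase_of_nonpos hx.le]
    · filter_upwards [lt_mem_nhds hx] with y hy
      rw [cantorStaircase_of_one_le hy.le, cantorStaircase_of_one_le hx.le]
  | succ n ih =>
    have h1 : 3 * x ∉ preCantorSet n := fun h => hx (Or.inl ⟨_, h, by ring⟩)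
    have h2 : 3 * x - 2 ∉ preCantorSet n := fun h => hx (Or.inr ⟨_, h, by ring⟩)
    have c1 : Continuous fun y : ℝ => 3 * y := by fun_prop
    have c2 : Continuous fun y : ℝ => 3 * y - 2 := by fun_prop
    filter_upwards [(c1.tendsto x).eventually (ih h1), (c2.tendsto x).eventually (ih h2)]
      with y hy1 hy2
    rw [cantorStaircase_eq, hy1, hy2, ← cantorStaircase_eq]

theorem eventually_cantorStaircase_eq {x : ℝ} (hx : x ∉ cantorSet) :
    ∀ᶠ y in nhds x, cantorStaircase y = cantorStaircase x := by
  rw [cantorSet, mem_iInter, not_forall] at hx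
  obtain ⟨n, hn⟩ := hx
  exact eventually_cantorStaircase_eq_of_notMem_preCantorSet n hn

theorem exists_cantorStaircase_eq (y : I) : ∃ x : I, cantorStaircase x = y := by
  obtain ⟨x, hx, h⟩ := intermediate_value_Icc zero_le_one continuous_cantorStaircase.continuousOn
    (show (y : ℝ) ∈ Icc (cantorStaircase 0) (cantorStaircase 1) by
      rw [cantorStaircase_of_nonpos le_rfl, cantorStaircase_of_one_le le_rfl]
      exact y.2)
  exact ⟨⟨x, hx⟩, h⟩

/-! ### Spaceability criteria -/

/-- If `Y` misses a closed subspace of full infinite dimension, then every finite-dimensional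
subspace that misses `Y` extends to a closed subspace of full dimension that misses `Y`. -/
theorem exists_isClosed_ge_disjoint {E : Type*} [NormedAddCommGroup E] [NormedSpace ℝ E]
    {Y M F : Submodule ℝ E} (hM : IsClosed (M : Set E)) (hMY : Disjoint M Y)
    (hrank : Module.rank ℝ M = Module.rank ℝ E) (hinf : ℵ₀ ≤ Module.rank ℝ E)
    [FiniteDimensional ℝ F] (hFY : Disjoint F Y) :
    ∃ G : Submodule ℝ E, Module.rank ℝ G = Module.rank ℝ E ∧ IsClosed (G : Set E) ∧ F ≤ G ∧
      Disjoint G Y := by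
  set N : Submodule ℝ E := M ⊓ (F ⊔ Y)
  -- Modulo `Y`, `N` lands in the image of `F`, and injectively because `M` misses `Y`.
  have hfin : FiniteDimensional ℝ N := by
    have hmem : ∀ x : N, Y.mkQ.comp N.subtype x ∈ F.map Y.mkQ := fun x => by
      obtain ⟨f, hf, y, hy, h⟩ := Submodule.mem_sup.1 x.2.2
      refine ⟨f, hf, ?_⟩
      have hy0 : Y.mkQ y = 0 := (Submodule.Quotient.mk_eq_zero Y).2 hy
      rw [LinearMap.comp_apply, N.subtype_apply, ← h, map_add, hy0, add_zero]
    refine Module.Finite.of_injective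
      ((Y.mkQ.comp N.subtype).codRestrict (F.map Y.mkQ) hmem) ?_
    rw [← LinearMap.ker_eq_bot, LinearMap.ker_codRestrict, LinearMap.ker_eq_bot']
    intro x hx
    have hx' : (x : E) ∈ Y := (Submodule.Quotient.mk_eq_zero Y).1 hx
    exact Subtype.ext (Submodule.disjoint_def.1 hMY _ x.2.1 hx')
  obtain ⟨P, hP, hNP⟩ :=
    (Submodule.ClosedComplemented.of_finiteDimensional N).exists_isClosed_isCompl
  have hclosed : IsClosed ((M ⊓ P : Submodule ℝ E) : Set E) := hM.inter hP
  refine ⟨(M ⊓ P) ⊔ F, le_antisymm (Submodule.rank_le _) ?_,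
    Submodule.isClosed_sup_finiteDimensional _ _ hclosed, le_sup_right, ?_⟩
  · have hle : M ≤ ((M ⊓ P) ⊔ F) ⊔ N := by
      intro x hx
      obtain ⟨n, hn, p, hp, rfl⟩ :=
        Submodule.mem_sup.1 (hNP.sup_eq_top ▸ Submodule.mem_top : x ∈ N ⊔ P)
      have hpM : p ∈ M := by simpa using M.sub_mem hx hn.1
      exact add_mem (Submodule.mem_sup_right hn)
        (Submodule.mem_sup_left (Submodule.mem_sup_left ⟨hpM, hp⟩))
    -- Adding the finite rank of `N` cannot raise a smaller rank to the infinite rank of `E`.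
    have h1 := (Submodule.rank_mono hle).trans (Submodule.rank_add_le_rank_add_rank _ _)
    rw [hrank] at h1
    by_contra! hlt
    exact absurd h1 (not_le.2 (Cardinal.add_lt_of_lt hinf hlt
      ((Module.rank_lt_aleph0 ℝ N).trans_le hinf)))
  · rw [Submodule.disjoint_def]
    intro x hx hxY
    obtain ⟨m, hm, f, hf, rfl⟩ := Submodule.mem_sup.1 hx
    have hmN : m ∈ N := ⟨hm.1, by
      have : m = -f + (m + f) := by abel
      rw [this]
      exact add_mem (Submodule.mem_sup_left (F.neg_mem hf)) (Submodule.mem_sup_right hxY)⟩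
    obtain rfl : m = 0 := Submodule.disjoint_def.1 hNP.disjoint m hmN hm.2
    rw [zero_add] at hxY ⊢
    exact Submodule.disjoint_def.1 hFY f hf hxY

/-- An infinite-dimensional subspace missing `Y` can be replaced by one of the same dimension that
misses `Y` but whose closure contains a prescribed vector of `Y`. -/
theorem exists_rank_eq_disjoint_mem_closure {E : Type*} [NormedAddCommGroup E] [NormedSpace ℝ E]
    {Y W : Submodule ℝ E} (hWY : Disjoint W Y) (hinf : ℵ₀ ≤ Module.rank ℝ W) {g : E}
    (hg : g ∈ Y) :
    ∃ F : Submodule ℝ E, Module.rank ℝ F = Module.rank ℝ W ∧ Disjoint F Y ∧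
      g ∈ closure (F : Set E) := by
  let b := Module.Basis.ofVectorSpace ℝ W
  have : Infinite (Module.Basis.ofVectorSpaceIndex ℝ W) := by
    rwa [← b.mk_eq_rank'', ← Cardinal.infinite_iff] at hinf
  let e := Infinite.natEmbedding (Module.Basis.ofVectorSpaceIndex ℝ W)
  -- On the chosen basis vectors φ outgrows (n + 1) times the norm, so b (e n) / φ (b (e n)) tends
  -- to 0 while its sheared image tends to g. The default 0 on the other basis vectors is
  -- immaterial.
  let φ : W →ₗ[ℝ] ℝ := b.constr ℝ
    (Function.extend e (fun n : ℕ => ((n : ℝ) + 1) * (‖b (e n)‖ + 1)) 0)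
  have hφ : ∀ n : ℕ, φ (b (e n)) = ((n : ℝ) + 1) * (‖b (e n)‖ + 1) := fun n => by
    simp only [φ, Module.Basis.constr_basis]
    exact e.injective.extend_apply _ _ n
  let L : W →ₗ[ℝ] E := W.subtype + φ.smulRight g
  have hL : ∀ w, L w = w + φ w • g := fun w => rfl
  -- The shear changes w only by an element of `Y`; this gives both injectivity and disjointness.
  have hLY : ∀ w, L w ∈ Y → w = 0 := fun w hw => by
    have : (w : E) ∈ Y := by
      have := Y.sub_mem hw (Y.smul_mem (φ w) hg)
      rwa [hL, add_sub_cancel_right] at this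
    exact Subtype.ext (Submodule.disjoint_def.1 hWY _ w.2 this)
  have hinj : Function.Injective L := by
    rw [← LinearMap.ker_eq_bot, LinearMap.ker_eq_bot']
    exact fun w hw => hLY w (hw ▸ Y.zero_mem)
  refine ⟨L.range, (LinearEquiv.ofInjective L hinj).rank_eq.symm, ?_, ?_⟩
  · rw [Submodule.disjoint_def]
    rintro _ ⟨w, rfl⟩ hw
    rw [hLY w hw, map_zero]
  · rw [Metric.mem_closure_iff]
    intro ε hε
    obtain ⟨n, hn⟩ := exists_nat_one_div_lt hε
    have hpos : 0 < φ (b (e n)) := by rw [hφ]; positivity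
    refine ⟨L ((φ (b (e n)))⁻¹ • b (e n)), ⟨_, rfl⟩, ?_⟩
    rw [hL, map_smul, smul_eq_mul, inv_mul_cancel₀ hpos.ne', one_smul, dist_comm, dist_eq_norm,
      add_sub_cancel_right, Submodule.coe_smul, norm_smul, norm_inv, Real.norm_of_nonneg hpos.le]
    refine lt_of_le_of_lt ?_ hn
    rw [inv_mul_le_iff₀ hpos, hφ, Submodule.coe_norm]
    have : (0 : ℝ) < n + 1 := by positivity
    field_simp
    linarith

/-! ### Hinge functions are linearly independent -/

/-- The hinge at s has a corner there, whereas every combination of the other hinges is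
differentiable at s. -/
theorem linearIndependent_max_projIcc_sub :
    LinearIndependent ℝ fun (t : Ioo (0 : ℝ) 1) (y : ℝ) =>
      max ((projIcc 0 1 zero_le_one y : ℝ) - t) 0 := by
  rw [linearIndependent_iff_notMem_span]
  rintro ⟨s, hs⟩ hmem
  have hproj : ∀ᶠ y in nhds s, (projIcc (0 : ℝ) 1 zero_le_one y : ℝ) = y := by
    filter_upwards [Ioo_mem_nhds hs.1 hs.2] with y hy
    rw [projIcc_of_mem _ ⟨hy.1.le, hy.2.le⟩]
  let D : Submodule ℝ (ℝ → ℝ) :=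
    { carrier := {h | DifferentiableAt ℝ h s}
      zero_mem' := differentiableAt_const 0
      add_mem' := fun hf hg => hf.add hg
      smul_mem' := fun c _ hf => hf.const_smul c }
  have hD : DifferentiableAt ℝ (fun y => max ((projIcc (0 : ℝ) 1 zero_le_one y : ℝ) - s) 0) s := by
    refine (Submodule.span_le (p := D)).2 ?_ hmem
    rintro _ ⟨⟨t, ht⟩, hts, rfl⟩
    have hne : t ≠ s := fun h => hts.2 (Subtype.ext h)
    change DifferentiableAt ℝ (fun y => max ((projIcc (0 : ℝ) 1 zero_le_one y : ℝ) - t) 0) s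
    rcases hne.lt_or_gt with h | h
    · refine (differentiableAt_id.sub_const t).congr_of_eventuallyEq ?_
      filter_upwards [hproj, lt_mem_nhds h] with y hy hty
      rw [hy, max_eq_left (sub_nonneg.2 hty.le), id]
    · refine (differentiableAt_const (0 : ℝ)).congr_of_eventuallyEq ?_
      filter_upwards [hproj, gt_mem_nhds h] with y hy hty
      rw [hy, max_eq_right (sub_nonpos.2 hty.le)]
  have hD' : DifferentiableAt ℝ (fun y : ℝ => max (y - s) 0) s := by
    refine hD.congr_of_eventuallyEq ?_
    filter_upwards [hproj] with y hy
    rw [hy]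
  have hD0 : DifferentiableAt ℝ (fun y : ℝ => max y 0) 0 := by
    have h : DifferentiableAt ℝ (fun y : ℝ => y + s) 0 := by fun_prop
    have h2 : DifferentiableAt ℝ (fun y : ℝ => max (y - s) 0) ((fun y : ℝ => y + s) 0) := by
      simpa using hD'
    simpa [Function.comp_def] using h2.comp (0 : ℝ) h
  refine not_differentiableAt_abs_zero ?_
  have habs : (abs : ℝ → ℝ) = fun y => 2 * max y 0 - y := by
    funext y
    rcases le_total y 0 with h | h
    · rw [abs_of_nonpos h, max_eq_right h]; ring
    · rw [abs_of_nonneg h, max_eq_left h]; ring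
  rw [habs]
  exact (hD0.const_mul 2).sub differentiableAt_id

/-! ### Functions that factor through the Cantor function -/

namespace BVC

theorem add_apply (f g : BVC) (x : I) : (f + g) x = f x + g x := by
  rw [map_add, ContinuousMap.add_apply]

theorem smul_apply (c : ℝ) (f : BVC) (x : I) : (c • f) x = c * f x := by
  rw [map_smul, ContinuousMap.smul_apply, smul_eq_mul]

theorem zero_apply (x : I) : (0 : BVC) x = 0 := by
  rw [map_zero, ContinuousMap.zero_apply]

theorem ext {f g : BVC} (h : ∀ x : I, f x = g x) : f = g :=
  toContinuousMap_injective (ContinuousMap.ext h)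

theorem continuous_apply (x : I) : Continuous fun f : BVC => f x := by
  have h : Continuous toContinuousMap :=
    AddMonoidHomClass.continuous_of_bound toContinuousMap 1 fun f => by
      rw [one_mul, norm_def]
      exact le_add_of_nonneg_right ENNReal.toReal_nonneg
  exact (continuous_eval_const x).comp h

/-- A continuous monotone function, as an element of `BVC`. -/
noncomputable def ofMonotone (f : C(I, ℝ)) (hf : Monotone f) : BVC :=
  ⟨f, by
    have h := (hf.monotoneOn univ).eVariationOn_eq (mem_univ 0) (mem_univ 1)
    have hI : (univ : Set I) ∩ Icc 0 1 = univ := by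
      rw [univ_inter]
      exact eq_univ_of_forall fun x => ⟨unitInterval.nonneg', unitInterval.le_one'⟩
    rw [hI] at h
    exact h.trans_ne ENNReal.ofReal_ne_top⟩

theorem ofMonotone_apply (f : C(I, ℝ)) (hf : Monotone f) (x : I) : ofMonotone f hf x = f x := rfl

/-- A continuous function is determined by its values on a dense sequence, which leaves at most 𝔠 ^
ℵ₀ = 𝔠 functions. -/
theorem rank_le_continuum : Module.rank ℝ BVC ≤ 𝔠 := by
  refine (rank_le_card ℝ BVC).trans ?_
  have hinj : Function.Injective fun (f : BVC) (n : ℕ) => f (TopologicalSpace.denseSeq I n) := by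
    intro f g h
    refine toContinuousMap_injective (DFunLike.coe_injective ?_)
    refine Continuous.ext_on (TopologicalSpace.denseRange_denseSeq I)
      (toContinuousMap f).continuous (toContinuousMap g).continuous ?_
    rintro _ ⟨n, rfl⟩
    exact congrFun h n
  refine (Cardinal.mk_le_of_injective hinj).trans ?_
  rw [Cardinal.mk_pi, Cardinal.prod_const]
  simp [Cardinal.mk_real]

/-- The absolutely continuous functions, as a subspace of `BVC`. -/
noncomputable def acSubmodule : Submodule ℝ BVC where
  carrier := {f | (f : I → ℝ) ∈ AC}
  zero_mem' := by
    have h : IccExtend (zero_le_one' ℝ) ((0 : BVC) : I → ℝ) = fun _ => 0 :=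
      funext fun x => zero_apply _
    change AbsolutelyContinuousOnInterval _ 0 1
    rw [h]
    exact ((LipschitzWith.const (0 : ℝ)).lipschitzOnWith).absolutelyContinuousOnInterval
  add_mem' := fun {f g} hf hg => by
    have h : IccExtend (zero_le_one' ℝ) ((f + g : BVC) : I → ℝ)
        = IccExtend (zero_le_one' ℝ) (f : I → ℝ) + IccExtend (zero_le_one' ℝ) (g : I → ℝ) :=
      funext fun x => add_apply f g _
    change AbsolutelyContinuousOnInterval _ 0 1
    rw [h]
    exact AbsolutelyContinuousOnInterval.add hf hg
  smul_mem' := fun c f hf => by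
    have h : IccExtend (zero_le_one' ℝ) ((c • f : BVC) : I → ℝ)
        = fun x => c • IccExtend (zero_le_one' ℝ) (f : I → ℝ) x :=
      funext fun x => smul_apply c f _
    change AbsolutelyContinuousOnInterval _ 0 1
    rw [h]
    exact AbsolutelyContinuousOnInterval.const_smul c hf

theorem exists_ne_zero_mem_acSubmodule : ∃ f ∈ acSubmodule, f ≠ 0 := by
  refine ⟨ofMonotone ⟨Subtype.val, continuous_subtype_val⟩ (Subtype.mono_coe _), ?_, fun h => ?_⟩
  · refine LipschitzOnWith.absolutelyContinuousOnInterval (K := 1) ?_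
    exact (LipschitzWith.projIcc zero_le_one).lipschitzOnWith
  · have h1 := congrArg (fun f : BVC => f 1) h
    simp only [ofMonotone_apply, zero_apply] at h1
    exact one_ne_zero h1

/-- The functions in `BVC` that vanish at `0` and factor through the Cantor function. -/
noncomputable def cantorSubmodule : Submodule ℝ BVC where
  carrier := {f | f 0 = 0 ∧ ∀ x y : I, cantorStaircase x = cantorStaircase y → f x = f y}
  zero_mem' := ⟨zero_apply 0, fun x y _ => by rw [zero_apply, zero_apply]⟩
  add_mem' := fun {f g} hf hg => ⟨by rw [add_apply, hf.1, hg.1, add_zero], fun x y h => by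
    rw [add_apply, add_apply, hf.2 x y h, hg.2 x y h]⟩
  smul_mem' := fun c f hf => ⟨by rw [smul_apply, hf.1, mul_zero], fun x y h => by
    rw [smul_apply, smul_apply, hf.2 x y h]⟩

theorem isClosed_cantorSubmodule : IsClosed (cantorSubmodule : Set BVC) := by
  have h : (cantorSubmodule : Set BVC) = {f | f 0 = 0} ∩
      ⋂ (x : I) (y : I) (_ : cantorStaircase x = cantorStaircase y), {f | f x = f y} := by
    ext f
    simp only [mem_inter_iff, mem_iInter]
    rfl
  rw [h]
  exact (isClosed_eq (continuous_apply 0) continuous_const).inter <|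
    isClosed_iInter fun x => isClosed_iInter fun y => isClosed_iInter fun _ =>
      isClosed_eq (continuous_apply x) (continuous_apply y)

/-- Off the null Cantor set these functions have derivative 0, so absolute continuity forces them to
be constant; the value at 0 fixes the constant. -/
theorem disjoint_cantorSubmodule_acSubmodule : Disjoint cantorSubmodule acSubmodule := by
  rw [Submodule.disjoint_def]
  rintro f ⟨h0, hf⟩ hAC
  have hae : ∀ᵐ x : ℝ, x ∈ uIcc (0 : ℝ) 1 →
      HasDerivAt (IccExtend (zero_le_one' ℝ) (f : I → ℝ)) 0 x := by
    filter_upwards [MeasureTheory.measure_eq_zero_iff_ae_notMem.1 volume_cantorSet] with x hx _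
    refine (hasDerivAt_const x (f (projIcc 0 1 zero_le_one x))).congr_of_eventuallyEq ?_
    filter_upwards [eventually_cantorStaircase_eq hx] with y hy
    exact hf _ _ (by rw [cantorStaircase_projIcc, cantorStaircase_projIcc, hy])
  obtain ⟨C, hC⟩ := AbsolutelyContinuousOnInterval.const_of_ae_hasDerivAt_zero hAC hae
  rw [uIcc_of_le zero_le_one] at hC
  have hC' : ∀ x : I, f x = C := fun x => by
    rw [← hC x x.2, IccExtend_val]
  exact ext fun x => by rw [zero_apply, hC', ← hC' 0, h0]

/-- The hinge functions composed with the Cantor function. -/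
noncomputable def cantorHinge (t : ℝ) : BVC :=
  ofMonotone ⟨fun x : I => max (cantorStaircase x - t) 0,
    ((continuous_cantorStaircase.comp continuous_subtype_val).sub continuous_const).max continuous_const⟩
    fun _ _ h => max_le_max (sub_le_sub_right (monotone_cantorStaircase h) t) le_rfl

theorem cantorHinge_apply (t : ℝ) (x : I) :
    cantorHinge t x = max (cantorStaircase x - t) 0 := rfl

theorem cantorHinge_mem {t : ℝ} (ht : 0 ≤ t) : cantorHinge t ∈ cantorSubmodule := by
  refine ⟨?_, fun x y h => by rw [cantorHinge_apply, cantorHinge_apply, h]⟩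
  rw [cantorHinge_apply, Icc.coe_zero, cantorStaircase_of_nonpos le_rfl]
  exact max_eq_right (by linarith)

/-- Composing with a section of the Cantor function turns the Cantor hinges into ordinary ones,
whose independence is known. -/
theorem continuum_le_rank_cantorSubmodule : 𝔠 ≤ Module.rank ℝ cantorSubmodule := by
  choose s hs using exists_cantorStaircase_eq
  let Φ : cantorSubmodule →ₗ[ℝ] (ℝ → ℝ) :=
    { toFun := fun f y => (f : BVC) (s (projIcc 0 1 zero_le_one y))
      map_add' := fun f g => funext fun y => add_apply (f : BVC) g _
      map_smul' := fun c f => funext fun y => smul_apply c (f : BVC) _ }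
  have h : LinearIndependent ℝ fun t : Ioo (0 : ℝ) 1 =>
      (⟨cantorHinge t, cantorHinge_mem t.2.1.le⟩ : cantorSubmodule) := by
    refine LinearIndependent.of_comp Φ ?_
    convert linearIndependent_max_projIcc_sub using 3 with t y
    change cantorHinge t (s _) = _
    rw [cantorHinge_apply, hs]
  exact (Cardinal.mk_Ioo_real zero_lt_one).symm.le.trans h.cardinal_le_rank

theorem rank_cantorSubmodule : Module.rank ℝ cantorSubmodule = 𝔠 :=
  le_antisymm ((Submodule.rank_le _).trans rank_le_continuum) continuum_le_rank_cantorSubmodule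

theorem rank_eq_continuum : Module.rank ℝ BVC = 𝔠 :=
  le_antisymm rank_le_continuum (continuum_le_rank_cantorSubmodule.trans (Submodule.rank_le _))

theorem subset_compl_ac_union_iff_disjoint (F : Submodule ℝ BVC) :
    (F : Set BVC) ⊆ {f : BVC | (f : I → ℝ) ∉ AC} ∪ {0} ↔ Disjoint F acSubmodule := by
  rw [Submodule.disjoint_def]
  exact forall₂_congr fun f _ => (or_iff_not_imp_left (a := (f : I → ℝ) ∉ AC)).trans
    (by rw [not_not]; rfl)

end BVC

open BVC in
theorem mainTheorem11 (α : Cardinal.{0}) :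
    IsPairSpaceable ℝ α 𝔠 {f : BVC | (f : I → ℝ) ∉ AC} ↔ α < ℵ₀ := by
  constructor
  · rintro ⟨⟨W, hW, hWAC⟩, hext⟩
    by_contra! hα
    rw [sdiff_subset_iff, union_comm, subset_compl_ac_union_iff_disjoint] at hWAC
    obtain ⟨g, hg, hg0⟩ := exists_ne_zero_mem_acSubmodule
    obtain ⟨F, hF, hFAC, hgF⟩ := exists_rank_eq_disjoint_mem_closure hWAC (hα.trans hW.ge) hg
    obtain ⟨G, -, hGclosed, hFG, hGAC⟩ :=
      hext F (hF.trans hW) ((subset_compl_ac_union_iff_disjoint F).2 hFAC)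
    rw [subset_compl_ac_union_iff_disjoint, Submodule.disjoint_def] at hGAC
    exact hg0 (hGAC g (closure_minimal hFG hGclosed hgF) hg)
  · intro hα
    refine ⟨?_, fun F hF hFAC => ?_⟩
    · obtain ⟨n, rfl⟩ := Cardinal.lt_aleph0.1 hα
      -- Lineability: a copy of ℝⁿ inside `cantorSubmodule`.
      obtain ⟨L, hL⟩ := Module.le_rank_iff_exists_linearMap.1
        ((Cardinal.natCast_lt_aleph0.le.trans Cardinal.aleph0_le_continuum).trans
          continuum_le_rank_cantorSubmodule : (n : Cardinal) ≤ _)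
      let T := cantorSubmodule.subtype.comp L
      have hT : Function.Injective T := cantorSubmodule.subtype_injective.comp hL
      refine ⟨T.range, ?_, ?_⟩
      · rw [← (LinearEquiv.ofInjective T hT).rank_eq, rank_fin_fun]
      · rw [sdiff_subset_iff, union_comm, subset_compl_ac_union_iff_disjoint]
        refine disjoint_cantorSubmodule_acSubmodule.mono_left ?_
        rintro _ ⟨v, rfl⟩
        exact (L v).2
    · have : FiniteDimensional ℝ F := Module.rank_lt_aleph0_iff.1 (hF.trans_lt hα)
      obtain ⟨G, hG, hGclosed, hFG, hGAC⟩ := exists_isClosed_ge_disjoint isClosed_cantorSubmodule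
        disjoint_cantorSubmodule_acSubmodule (rank_cantorSubmodule.trans rank_eq_continuum.symm)
        (Cardinal.aleph0_le_continuum.trans rank_eq_continuum.ge)
        ((subset_compl_ac_union_iff_disjoint F).1 hFAC)
      exact ⟨G, hG.trans rank_eq_continuum, hGclosed, hFG,
        (subset_compl_ac_union_iff_disjoint G).2 hGAC⟩
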